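/- Let $n\ge 1$ and let $E\subset\mathbb R^n$ be a closed set that is the closure of its interior and has $C^{1,1}$ boundary: every $x\in\partial E$ has a neighbourhood $U$ in which, after an orthogonal change of coordinates $\mathbb R^n\cong\mathbb R^{n-1}\times\mathbb R$, $\partial E\cap U$ is the part in $U$ of the graph of a differentiable function $f:\mathbb R^{n-1}\to\mathbb R$ with Lipschitz derivative. For a closed set $A$ let $$\operatorname{reach}(A)=\sup\{r\ge 0 : \text{every } x \text{ with } \operatorname{dist}(x,A)\le r \text{ has exactly one nearest point in } A\}\in[0,\infty],$$ where no point has finite distance from the empty set, and put $\hat\kappa=1/\operatorname{reach}(\partial E)\in[0,\infty]$, with $1/0=\infty$ and $1/\infty=0$. Let $E_\varepsilon=\{x:\operatorname{dist}(x,E)<\varepsilon\}$, and let $\mathcal C^E_d$ be the union of all closed dyadic cubes $\prod_{j=1}^n[m_j2^{-d},(m_j+1)2^{-d}]$, $m_j\in\mathbb Z$, that meet $E$. Then the following hold. 1. If $\partial E$ is compact, then $\operatorname{reach}(\partial E)>0$, that is, $\hat\kappa<\infty$. 2. At $\mathcal H^{n-1}$-almost every $x\in\partial E$ the outer unit normal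 field of $E$ is differentiable along $\partial E$, its differential is diagonalizable in an orthonormal basis of the tangent space, and its eigenvalues, the principal curvatures $\kappa_1,\dots,\kappa_{n-1}$ of $\partial E$ at $x$, satisfy $|\kappa_i|\le\hat\kappa$. 3. For every $\varepsilon>0$, $$\mathcal L^n(E_\varepsilon)\le(1+\varepsilon\hat\kappa)^n\,\mathcal L^n(E),$$ and, with $d(\varepsilon)=\log_2(\sqrt n/\varepsilon)$, $$\mathcal L^n(\mathcal C^E_{d})\le(1+\varepsilon\hat\kappa)^n\,\mathcal L^n(E)\qquad\text{for every integer } d\ge 0 \text{ with } d\ge d(\varepsilon),$$ in particular for $d=d(\varepsilon)$ when $d(\varepsilon)$ is a nonnegative integer. Both inequalities are read in $[0,\infty]$. -/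

import Mathlib

open MeasureTheory Filter Topology
open scoped NNReal ENNReal

namespace CubicalCover

noncomputable section

/-- The closed dyadic `n`-cube `∏ⱼ [mⱼ 2⁻ᵈ, (mⱼ + 1) 2⁻ᵈ]` of side length `2⁻ᵈ`. -/
def dyadicCube {n : ℕ} (d : ℕ) (m : Fin n → ℤ) : Set (EuclideanSpace ℝ (Fin n)) :=
  {x | ∀ j, (m j : ℝ) / 2 ^ d ≤ x j ∧ x j ≤ ((m j : ℝ) + 1) / 2 ^ d}

/-- The cubical cover of `E` at level `d`: the union of all closed dyadic cubes of side length
`2⁻ᵈ` that meet `E`. -/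
def cubicalCover {n : ℕ} (E : Set (EuclideanSpace ℝ (Fin n))) (d : ℕ) :
    Set (EuclideanSpace ℝ (Fin n)) :=
  ⋃ (m : Fin n → ℤ) (_ : (dyadicCube d m ∩ E).Nonempty), dyadicCube d m

/-- The set of nearest points of `A` to `x`. -/
def cls {X : Type*} [MetricSpace X] (A : Set X) (x : X) : Set X :=
  {y | y ∈ A ∧ Metric.infDist x A = dist x y}

/-- The points that have exactly one nearest point in `A`. -/
def unique {X : Type*} [MetricSpace X] (A : Set X) : Set X :=
  {x | ∃! y, y ∈ cls A x}

/-- The reach of `A`, in `[0, ∞]`: the supremum of all `r ≥ 0` such that every point at distance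
at most `r` from `A` has a unique nearest point in `A`. -/
def reach {X : Type*} [MetricSpace X] (A : Set X) : ℝ≥0∞ :=
  ⨆ (r : ℝ≥0) (_ : Metric.cthickening (r : ℝ) A ⊆ unique A), (r : ℝ≥0∞)

/-- `f` is of class `C^{1,1}`: it is differentiable and its derivative is Lipschitz. -/
def IsC11 {k : ℕ} (f : EuclideanSpace ℝ (Fin k) → ℝ) : Prop :=
  Differentiable ℝ f ∧ ∃ K : ℝ≥0, LipschitzWith K (fderiv ℝ f)

/-- The boundary of `E` is `C^{1,1}`: every boundary point has a neighbourhood `U` in which,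
after an orthogonal change of coordinates `Φ : ℝⁿ ≃ ℝⁿ⁻¹ × ℝ`, the boundary is the graph of a
`C^{1,1}` function. -/
def HasC11Boundary {n : ℕ} (E : Set (EuclideanSpace ℝ (Fin n))) : Prop :=
  ∀ x ∈ frontier E, ∃ U ∈ 𝓝 x,
    ∃ Φ : EuclideanSpace ℝ (Fin n) ≃ₗᵢ[ℝ] WithLp 2 (EuclideanSpace ℝ (Fin (n - 1)) × ℝ),
    ∃ f : EuclideanSpace ℝ (Fin (n - 1)) → ℝ, IsC11 f ∧
      frontier E ∩ U = {y | (Φ y).snd = f (Φ y).fst} ∩ U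

/-- `u` is the outer unit normal of `E` at `x`: to first order at `x`, the set `E` is the half
space `{y | ⟪y - x, u⟫ ≤ 0}`. -/
def IsOuterUnitNormal {n : ℕ} (E : Set (EuclideanSpace ℝ (Fin n)))
    (x u : EuclideanSpace ℝ (Fin n)) : Prop :=
  ‖u‖ = 1 ∧ ∀ η : ℝ, 0 < η → ∀ᶠ y in 𝓝 x,
    (η * ‖y - x‖ < inner ℝ (y - x) u → y ∉ E) ∧
    (inner ℝ (y - x) u < -(η * ‖y - x‖) → y ∈ E)

/-- The second fundamental form of the boundary of `E` exists at `x` and `κ` lists the principal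
curvatures there: the outer unit normal field `ν` is differentiable along the boundary at `x`, and
its differential `S` has an orthonormal system of `n - 1` tangential eigenvectors with the
eigenvalues `κ i`. (For a ball of radius `r` all of them are `1 / r`.) -/
def HasPrincipalCurvatures {n : ℕ} (E : Set (EuclideanSpace ℝ (Fin n)))
    (x : EuclideanSpace ℝ (Fin n)) (κ : Fin (n - 1) → ℝ) : Prop :=
  ∃ ν : EuclideanSpace ℝ (Fin n) → EuclideanSpace ℝ (Fin n),
    (∀ᶠ y in 𝓝[frontier E] x, IsOuterUnitNormal E y (ν y)) ∧
    ∃ S : EuclideanSpace ℝ (Fin n) →L[ℝ] EuclideanSpace ℝ (Fin n),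
      HasFDerivWithinAt ν S (frontier E) x ∧
      ∃ e : Fin (n - 1) → EuclideanSpace ℝ (Fin n), Orthonormal ℝ e ∧
        ∀ i, inner ℝ (e i) (ν x) = 0 ∧ S (e i) = κ i • e i

end

end CubicalCover

namespace CubicalCover

/-! Let r > 0 be such that points within r of ∂E have unique nearest points in ∂E. Uniqueness lets a
point escape from ∂E with the distance growing at unit speed, so every point of E lies in a closed
ball of radius r contained in E. Thus E = C + rB with C the set of centres of such balls, and E_ε
lies in C + (r + ε)B. Kneser's inequality vol(C + λrB) ≤ λⁿ vol(C + rB), with λ = 1 + ε/r, gives the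
volume bound (`addHaar_cthickening_mul_le`, `addHaar_cthickening_le`); then r tends to the reach. A
dyadic cube meeting E has diameter at most √n 2⁻ᵈ ≤ ε, so the cubical cover lies in the closed
ε-neighbourhood.

The same escape argument in the complement gives touching balls of radius r on both sides of ∂E,
that is 2r|⟨y - x, ν(x)⟩| ≤ |y - x|² on ∂E. Adding this to the inequality with x and y exchanged and
differentiating ν gives |κᵢ| r ≤ 1. The curvatures exist almost everywhere by Rademacher's theorem
for the derivative of the graph function, and symmetry of second derivatives makes the shape
operator diagonalizable. Conversely, Taylor's formula and compactness give a uniform bound |⟨y - x,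
ν(x)⟩| ≤ M|y - x|², which forces unique nearest points near ∂E; hence the reach is positive. -/

theorem mem_cthickening_iff_infDist_le {X : Type*} [PseudoMetricSpace X] {A : Set X}
    (hA : A.Nonempty) {r : ℝ} (hr : 0 ≤ r) {x : X} :
    x ∈ Metric.cthickening r A ↔ Metric.infDist x A ≤ r := by
  rw [Metric.mem_cthickening_iff, Metric.infDist,
    ENNReal.le_ofReal_iff_toReal_le (Metric.infEDist_ne_top hA) hr]

/-! ### Kneser's inequality for parallel sets -/

section Kneser

variable {F : Type*} [NormedAddCommGroup F] [InnerProductSpace ℝ F]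

/-- Add the two squared inequalities; all squares cancel. This is the monotonicity of nearest-point
maps, valid for any selection and without convexity. -/
theorem inner_sub_nearest_nonneg {a b p q : F} (hp : ‖a - p‖ ≤ ‖a - q‖)
    (hq : ‖b - q‖ ≤ ‖b - p‖) : 0 ≤ inner ℝ (a - b) (p - q) := by
  have h1 : ‖a - p‖ ^ 2 ≤ ‖a - q‖ ^ 2 := by gcongr
  have h2 : ‖b - q‖ ^ 2 ≤ ‖b - p‖ ^ 2 := by gcongr
  rw [norm_sub_sq_real, norm_sub_sq_real] at h1 h2
  simp only [inner_sub_left, inner_sub_right]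
  linarith

/-- Contracting every point towards its nearest point in a set expands distances at most by the
inverse factor when undone. -/
theorem antilipschitz_contraction_towards_nearest {C : Set F} {c : F → F}
    (hmem : ∀ y, c y ∈ C) (hc : ∀ y, ∀ p ∈ C, ‖y - c y‖ ≤ ‖y - p‖) {l : ℝ≥0} (hl : 1 ≤ l) :
    AntilipschitzWith l fun y => c y + (l : ℝ)⁻¹ • (y - c y) := by
  have hl' : (1 : ℝ) ≤ l := hl
  have hl0 : (l : ℝ) ≠ 0 := by positivity
  refine AntilipschitzWith.of_le_mul_dist fun a b => ?_
  rw [dist_eq_norm, dist_eq_norm]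
  -- The vector on the right is `l` times the difference of the images; its cross term is
  -- nonnegative by monotonicity.
  have key : ‖a - b‖ ≤ ‖(a - b) + ((l : ℝ) - 1) • (c a - c b)‖ := by
    refine le_of_sq_le_sq ?_ (norm_nonneg _)
    rw [norm_add_sq_real, inner_smul_right]
    have h := inner_sub_nearest_nonneg (hc a _ (hmem b)) (hc b _ (hmem a))
    have := mul_nonneg (sub_nonneg.2 hl') h
    nlinarith [sq_nonneg ‖((l : ℝ) - 1) • (c a - c b)‖]
  refine key.trans_eq ?_
  have h2 : (a - b) + ((l : ℝ) - 1) • (c a - c b) =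
      (l : ℝ) • ((c a + (l : ℝ)⁻¹ • (a - c a)) - (c b + (l : ℝ)⁻¹ • (b - c b))) := by
    simp only [smul_sub, smul_add, smul_smul, mul_inv_cancel₀ hl0, one_smul, sub_smul]
    abel
  rw [h2, norm_smul]
  simp

variable [FiniteDimensional ℝ F] [MeasurableSpace F] [BorelSpace F]

/-- Haar measure is a multiple of Hausdorff measure in the full dimension, for which the bound holds
without measurability of `s`. -/
theorem addHaar_le_of_antilipschitz (μ : Measure F) [μ.IsAddHaarMeasure] {l : ℝ≥0} {f : F → F}
    (hf : AntilipschitzWith l f) (s : Set F) :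
    μ s ≤ (l : ℝ≥0∞) ^ Module.finrank ℝ F * μ (f '' s) := by
  have h := hf.le_hausdorffMeasure_image (d := (Module.finrank ℝ F : ℝ)) (by positivity) s
  rw [Measure.isAddLeftInvariant_eq_smul μ (μH[(Module.finrank ℝ F : ℝ)] : Measure F)]
  simp only [Measure.smul_apply, ENNReal.smul_def, smul_eq_mul]
  rw [mul_left_comm]
  gcongr
  simpa using h

/-- Kneser's inequality: `r ↦ r ^ (-n) * vol (C + r B)` is nonincreasing. -/
theorem addHaar_cthickening_mul_le (μ : Measure F) [μ.IsAddHaarMeasure] {C : Set F}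
    (hC : IsClosed C) {r : ℝ} (hr : 0 ≤ r) {l : ℝ≥0} (hl : 1 ≤ l) :
    μ (Metric.cthickening (l * r) C) ≤
      (l : ℝ≥0∞) ^ Module.finrank ℝ F * μ (Metric.cthickening r C) := by
  have hl0 : (0 : ℝ) < l := lt_of_lt_of_le one_pos hl
  rcases C.eq_empty_or_nonempty with rfl | hne
  · simp
  choose c hmem hdist using fun y => hC.exists_infDist_eq_dist hne y
  have hc : ∀ y, ∀ p ∈ C, ‖y - c y‖ ≤ ‖y - p‖ := fun y p hp => by
    rw [← dist_eq_norm, ← dist_eq_norm, ← hdist]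
    exact Metric.infDist_le_dist_of_mem hp
  refine (addHaar_le_of_antilipschitz μ
    (antilipschitz_contraction_towards_nearest hmem hc hl) _).trans ?_
  gcongr
  rintro _ ⟨y, hy, rfl⟩
  refine Metric.mem_cthickening_of_dist_le _ (c y) _ _ (hmem y) ?_
  rw [mem_cthickening_iff_infDist_le hne (by positivity), hdist] at hy
  rw [dist_eq_norm, add_sub_cancel_left, norm_smul, norm_inv, ← dist_eq_norm]
  simp only [NNReal.norm_eq]
  rwa [inv_mul_le_iff₀ hl0]

end Kneser

/-! ### Inscribed balls -/

section Centers

variable {X : Type*} [PseudoMetricSpace X]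

/-- The set of centres of open balls of radius `r` inside `G`. -/
def ballCenters (r : ℝ) (G : Set X) : Set X := {q | ∀ y ∈ Gᶜ, r ≤ dist y q}

theorem ball_subset_of_mem_ballCenters {r : ℝ} {G : Set X} {q : X} (hq : q ∈ ballCenters r G) :
    Metric.ball q r ⊆ G := by
  intro y hy
  by_contra h
  exact (hq y h).not_gt hy

theorem isClosed_ballCenters (r : ℝ) (G : Set X) : IsClosed (ballCenters r G) := by
  have : ballCenters r G = ⋂ y ∈ Gᶜ, {q | r ≤ dist y q} := by
    ext; simp [ballCenters]
  rw [this]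
  exact isClosed_biInter fun y _ => isClosed_le continuous_const (by fun_prop)

end Centers

theorem subset_of_isPreconnected_of_disjoint_frontier {X : Type*} [TopologicalSpace X]
    {s G : Set X} (hs : IsPreconnected s) (hd : Disjoint s (frontier G)) (hne : (s ∩ G).Nonempty) :
    s ⊆ G := by
  have h := hs.subset_or_subset (isOpen_interior (s := G)) (isOpen_interior (s := Gᶜ))
    (by
      rw [interior_compl]
      exact (disjoint_compl_right (a := closure G)).mono_left (interior_subset.trans subset_closure))
    (by
      intro y hy
      have : y ∉ frontier G := fun h => Set.disjoint_left.1 hd hy h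
      rw [← compl_frontier_eq_union_interior]
      exact this)
  rcases h with h | h
  · exact h.trans interior_subset
  · obtain ⟨y, hys, hyG⟩ := hne
    exact absurd hyG (interior_subset (h hys))

/-! ### Escaping from a set with unique nearest points -/

section Reach

variable {F : Type*} [NormedAddCommGroup F] [InnerProductSpace ℝ F] [FiniteDimensional ℝ F]

/-- Move along the ray from the nearest point p through y. Points of `A` seen from y in a narrow
enough cone around p recede at rate at least `η`. The others are farther from y by a positive gap,
because p is the only nearest point and `A` is closed, so they do not matter for small h. -/
theorem infDist_growth_of_unique {A : Set F} (hA : IsClosed A) {y : F} (hy : 0 < Metric.infDist y A)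
    (hu : y ∈ unique A) {η : ℝ} (h0 : 0 < η) (h1 : η < 1) :
    ∃ u : F, ‖u‖ = 1 ∧ ∀ᶠ h in 𝓝[>] (0 : ℝ),
      Metric.infDist y A + η * h ≤ Metric.infDist (y + h • u) A := by
  obtain ⟨p, ⟨hpA, hp⟩, huniq⟩ := hu
  have hne : A.Nonempty := ⟨p, hpA⟩
  rw [dist_eq_norm] at hp
  have hd : 0 < ‖y - p‖ := hp ▸ hy
  refine ⟨‖y - p‖⁻¹ • (y - p), by rw [norm_smul, norm_inv, norm_norm, inv_mul_cancel₀ hd.ne'], ?_⟩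
  set u := ‖y - p‖⁻¹ • (y - p) with hudef
  have hu1 : ‖u‖ = 1 := by rw [hudef, norm_smul, norm_inv, norm_norm, inv_mul_cancel₀ hd.ne']
  have hup : inner ℝ u (y - p) = ‖y - p‖ := by
    rw [hudef, real_inner_smul_left, real_inner_self_eq_norm_sq]
    field_simp
  set W : Set F := {q | η * ‖y - q‖ < inner ℝ u (y - q)} with hW
  have hWo : IsOpen W := isOpen_lt (by fun_prop) (by fun_prop)
  have hpW : p ∈ W := by
    change η * ‖y - p‖ < inner ℝ u (y - p)
    rw [hup]; nlinarith
  have hAW : IsClosed (A \ W) := by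
    rw [Set.sdiff_eq]; exact hA.inter hWo.isClosed_compl
  obtain ⟨m, hm, hmle⟩ : ∃ m, ‖y - p‖ < m ∧ ∀ q ∈ A \ W, m ≤ ‖y - q‖ := by
    rcases (A \ W).eq_empty_or_nonempty with he | hne'
    · exact ⟨‖y - p‖ + 1, by linarith, by simp [he]⟩
    · obtain ⟨q, hq, hqd⟩ := hAW.exists_infDist_eq_dist hne' y
      refine ⟨‖y - q‖, ?_, fun q' hq' => ?_⟩
      · rw [← hp, ← dist_eq_norm]
        refine lt_of_le_of_ne (Metric.infDist_le_dist_of_mem hq.1) fun h => ?_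
        have := huniq q ⟨hq.1, h⟩
        exact hq.2 (this ▸ hpW)
      · rw [← dist_eq_norm, ← dist_eq_norm, ← hqd]
        exact Metric.infDist_le_dist_of_mem hq'
  have hev : ∀ᶠ h in 𝓝[>] (0 : ℝ), h < (m - ‖y - p‖) / 2 :=
    nhdsWithin_le_nhds (eventually_lt_nhds (by linarith))
  filter_upwards [hev, self_mem_nhdsWithin] with h hh hpos
  have hpos : 0 < h := hpos
  refine (Metric.le_infDist hne).2 fun {q} hq => ?_
  rw [hp, dist_eq_norm]
  have hrw : y + h • u - q = (y - q) + h • u := by abel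
  rw [hrw]
  by_cases hqW : q ∈ W
  · have hqd : ‖y - p‖ ≤ ‖y - q‖ := by
      rw [← hp, ← dist_eq_norm]; exact Metric.infDist_le_dist_of_mem hq
    refine (add_le_add_left hqd _).trans ?_
    refine le_of_sq_le_sq ?_ (norm_nonneg _)
    have hqW : η * ‖y - q‖ < inner ℝ u (y - q) := hqW
    rw [norm_add_sq_real, inner_smul_right, real_inner_comm, norm_smul, hu1, mul_one,
      Real.norm_eq_abs, sq_abs]
    have h5 := mul_lt_mul_of_pos_left hqW hpos
    have h6 : η ^ 2 * h ^ 2 ≤ 1 * h ^ 2 := by gcongr; nlinarith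
    nlinarith
  · have h3 := hmle q ⟨hq, hqW⟩
    have h4 : ‖y - q‖ ≤ ‖(y - q) + h • u‖ + ‖h • u‖ := by
      simpa using norm_sub_le ((y - q) + h • u) (h • u)
    rw [norm_smul, hu1, mul_one, Real.norm_eq_abs, abs_of_pos hpos] at h4
    nlinarith

/-- If all points within distance `r` of `A` have unique nearest points, then a point outside `A`
can be moved away from `A` at unit speed, up to distance `r`. -/
theorem exists_far_point_of_unique {A : Set F} (hA : IsClosed A) {r : ℝ}
    (hu : Metric.cthickening r A ⊆ unique A) {x : F} (hx : 0 < Metric.infDist x A)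
    (hxr : Metric.infDist x A ≤ r) :
    ∃ q, dist q x ≤ r - Metric.infDist x A ∧ r ≤ Metric.infDist q A := by
  have hne : A.Nonempty := by
    by_contra h
    rw [Set.not_nonempty_iff_eq_empty] at h
    simp [h] at hx
  set s := r - Metric.infDist x A with hs
  have hs0 : 0 ≤ s := by linarith
  have hcomp : IsCompact (Metric.closedBall x s) := isCompact_closedBall x s
  have hball : (Metric.closedBall x s).Nonempty := ⟨x, Metric.mem_closedBall_self hs0⟩
  obtain ⟨q, hq, hmax⟩ := hcomp.exists_isMaxOn hball
    (Metric.continuous_infDist_pt A).continuousOn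
  refine ⟨q, hq, ?_⟩
  have key : ∀ η ∈ Set.Ioo (0 : ℝ) 1, Metric.infDist x A + η * s ≤ Metric.infDist q A := by
    intro η hη
    -- A maximizer in the open ball could be improved by moving at the growth rate (1 + η)/2 > η. So
    -- it lies on the sphere of radius `s`, and its distance to `A` is at least that of `x` plus `η
    -- * s`.
    obtain ⟨y, hy, hymax⟩ := hcomp.exists_isMaxOn hball
      (f := fun y => Metric.infDist y A - η * dist y x) (by fun_prop)
    have hyx := hymax (Metric.mem_closedBall_self hs0)
    simp only [Set.mem_ofPred_eq, dist_self, mul_zero, sub_zero] at hyx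
    have hyq := hmax hy
    simp only [Set.mem_ofPred_eq] at hyq
    rcases (Metric.mem_closedBall.1 hy).lt_or_eq with hlt | heq
    · exfalso
      have hyle : Metric.infDist y A ≤ r := by
        have := Metric.infDist_le_infDist_add_dist (s := A) (x := y) (y := x)
        linarith
      have hypos : 0 < Metric.infDist y A := by
        have := mul_nonneg hη.1.le (dist_nonneg (x := y) (y := x))
        linarith
      obtain ⟨u, hu1, hev⟩ := infDist_growth_of_unique hA hypos
        (hu ((mem_cthickening_iff_infDist_le hne (hx.le.trans hxr)).2 hyle))
        (η := (1 + η) / 2) (by linarith [hη.1]) (by linarith [hη.2])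
      have hev2 : ∀ᶠ h in 𝓝[>] (0 : ℝ), h < s - dist y x :=
        nhdsWithin_le_nhds (eventually_lt_nhds (by linarith))
      obtain ⟨h, hh, hh2, hpos⟩ := (hev.and (hev2.and self_mem_nhdsWithin)).exists
      have hpos : 0 < h := hpos
      have hd : dist (y + h • u) x ≤ dist y x + h := by
        refine (dist_triangle _ y _).trans ?_
        rw [dist_eq_norm (y + h • u) y, add_sub_cancel_left, norm_smul, hu1, mul_one,
          Real.norm_eq_abs, abs_of_pos hpos]
        linarith
      have hz := hymax (a := y + h • u) (Metric.mem_closedBall.2 (by linarith))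
      simp only [Set.mem_ofPred_eq] at hz
      have := mul_le_mul_of_nonneg_left hd hη.1.le
      nlinarith [hη.2]
    · rw [heq] at hyx
      linarith
  have hlim : Tendsto (fun η : ℝ => Metric.infDist x A + η * s) (𝓝[<] 1)
      (𝓝 (Metric.infDist x A + 1 * s)) := by
    apply Tendsto.mono_left _ nhdsWithin_le_nhds
    apply Continuous.tendsto
    fun_prop
  have := le_of_tendsto hlim
    (Filter.mem_of_superset (Ioo_mem_nhdsLT (zero_lt_one' ℝ)) key)
  linarith

/-- From a point of `G`, escape to q at distance at least r from `A`, travelling less than r. The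
ball around q still contains the starting point and misses the frontier, so by connectedness it lies
in `G`. -/
theorem closure_subset_cthickening_ballCenters {A G : Set F} (hA : IsClosed A)
    (hGA : frontier G ⊆ A) (hdisj : Disjoint G A) {r : ℝ} (hr : 0 < r)
    (hu : Metric.cthickening r A ⊆ unique A) :
    closure G ⊆ Metric.cthickening r (ballCenters r G) := by
  refine closure_minimal (fun x hx => ?_) Metric.isClosed_cthickening
  have hxA : x ∉ A := Set.disjoint_left.1 hdisj hx
  suffices h : ∃ q, dist q x < r ∧ Disjoint (Metric.ball q r) A by
    obtain ⟨q, hqx, hq⟩ := h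
    refine Metric.mem_cthickening_of_dist_le x q _ _ ?_ (by rw [dist_comm]; exact hqx.le)
    have hsub : Metric.ball q r ⊆ G :=
      subset_of_isPreconnected_of_disjoint_frontier (convex_ball q r).isPreconnected
        (hq.mono_right hGA) ⟨x, by rwa [Metric.mem_ball, dist_comm], hx⟩
    intro y hy
    by_contra h
    exact hy (hsub (not_le.1 h))
  rcases A.eq_empty_or_nonempty with rfl | hne
  · exact ⟨x, by simpa using hr, by simp⟩
  have hpos : 0 < Metric.infDist x A := (hA.notMem_iff_infDist_pos hne).1 hxA
  have hfar : ∀ q, r ≤ Metric.infDist q A → Disjoint (Metric.ball q r) A := fun q hq =>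
    (Metric.disjoint_ball_infDist).mono_left (Metric.ball_subset_ball hq)
  rcases le_total r (Metric.infDist x A) with h | h
  · exact ⟨x, by simpa using hr, hfar x h⟩
  · obtain ⟨q, hqx, hq⟩ := exists_far_point_of_unique hA hu hpos h
    exact ⟨q, by linarith, hfar q hq⟩

end Reach

/-! ### Volume of neighbourhoods and of the cubical cover -/

section Volume

theorem frontier_interior_subset {X : Type*} [TopologicalSpace X] {s : Set X} :
    frontier (interior s) ⊆ frontier s := by
  rw [frontier, frontier, interior_interior]
  exact Set.sdiff_subset_sdiff_left (closure_mono interior_subset)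

section

variable {F : Type*} [NormedAddCommGroup F] [InnerProductSpace ℝ F] [FiniteDimensional ℝ F]

theorem cthickening_ballCenters_subset {G : Set F} {r : ℝ} (hr : 0 < r) :
    Metric.cthickening r (ballCenters r G) ⊆ closure G := by
  rw [(isClosed_ballCenters r G).cthickening_eq_biUnion_closedBall hr.le]
  refine Set.iUnion₂_subset fun q hq => ?_
  rw [← closure_ball q hr.ne']
  exact closure_mono (ball_subset_of_mem_ballCenters hq)

variable [MeasurableSpace F] [BorelSpace F]

theorem addHaar_cthickening_le (μ : Measure F) [μ.IsAddHaarMeasure] {E : Set F}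
    (hreg : closure (interior E) = E) {r ε : ℝ} (hr : 0 < r) (hε : 0 ≤ ε)
    (hu : Metric.cthickening r (frontier E) ⊆ unique (frontier E)) :
    μ (Metric.cthickening ε E) ≤
      (1 + ENNReal.ofReal ε * (ENNReal.ofReal r)⁻¹) ^ Module.finrank ℝ F * μ E := by
  set C := ballCenters r (interior E)
  have hsub : E ⊆ Metric.cthickening r C := by
    have := closure_subset_cthickening_ballCenters isClosed_frontier frontier_interior_subset
      disjoint_interior_frontier hr hu
    rwa [hreg] at this
  have hsup : Metric.cthickening r C ⊆ E := by
    have := cthickening_ballCenters_subset (G := interior E) hr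
    rwa [hreg] at this
  -- The dilation factor 1 + ε/r turns the radius r into r + ε.
  have hl : (1 : ℝ≥0) ≤ 1 + ε.toNNReal / r.toNNReal := by simp
  have h1 := addHaar_cthickening_mul_le μ (isClosed_ballCenters r (interior E)) hr.le hl
  have h2 : (((1 + ε.toNNReal / r.toNNReal : ℝ≥0) : ℝ)) * r = ε + r := by
    push_cast
    rw [Real.coe_toNNReal _ hε, Real.coe_toNNReal _ hr.le]
    field_simp
    ring
  have h3 : (((1 + ε.toNNReal / r.toNNReal : ℝ≥0) : ℝ≥0∞)) =
      1 + ENNReal.ofReal ε * (ENNReal.ofReal r)⁻¹ := by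
    rw [ENNReal.coe_add, ENNReal.coe_div (by simpa using hr), ENNReal.coe_one, div_eq_mul_inv]
    rfl
  rw [h2, h3] at h1
  calc μ (Metric.cthickening ε E) ≤ μ (Metric.cthickening ε (Metric.cthickening r C)) :=
        measure_mono (Metric.cthickening_subset_of_subset _ hsub)
    _ ≤ μ (Metric.cthickening (ε + r) C) :=
        measure_mono (Metric.cthickening_cthickening_subset hε hr.le C)
    _ ≤ _ := h1.trans (by gcongr)

theorem exists_lt_of_lt_reach {X : Type*} [MetricSpace X] {A : Set X} {a : ℝ≥0∞}
    (h : a < reach A) : ∃ r : ℝ≥0, a < r ∧ Metric.cthickening (r : ℝ) A ⊆ unique A := by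
  simp only [reach, lt_iSup_iff] at h
  obtain ⟨r, hr, h⟩ := h
  exact ⟨r, h, hr⟩

/-- The supremum defining the reach need not be attained, so the bound is passed to the limit from
below. For reach zero the right side is ∞, since a nonempty regular closed set has positive measure
and the dimension is not zero. -/
theorem addHaar_cthickening_le_reach (μ : Measure F) [μ.IsAddHaarMeasure] {E : Set F}
    (hreg : closure (interior E) = E) (hdim : Module.finrank ℝ F ≠ 0) {ε : ℝ} (hε : 0 < ε) :
    μ (Metric.cthickening ε E) ≤
      (1 + ENNReal.ofReal ε * (reach (frontier E))⁻¹) ^ Module.finrank ℝ F * μ E := by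
  have hε' : ENNReal.ofReal ε ≠ 0 := by simpa using hε
  rcases E.eq_empty_or_nonempty with rfl | hne
  · simp
  have hpos : μ E ≠ 0 := by
    have hi : (interior E).Nonempty := by
      rw [← closure_nonempty_iff, hreg]; exact hne
    exact (lt_of_lt_of_le (isOpen_interior.measure_pos μ hi) (measure_mono interior_subset)).ne'
  rcases eq_or_ne (reach (frontier E)) 0 with h0 | h0
  · rw [h0, ENNReal.inv_zero, ENNReal.mul_top hε', add_top, ENNReal.top_pow hdim,
      ENNReal.top_mul hpos]
    exact le_top
  rcases eq_or_ne (μ E) ⊤ with ht | ht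
  · rw [ht, ENNReal.mul_top (pow_ne_zero _ (by simp))]
    exact le_top
  have hb : ∀ a < reach (frontier E), 0 < a → μ (Metric.cthickening ε E) ≤
      (1 + ENNReal.ofReal ε * a⁻¹) ^ Module.finrank ℝ F * μ E := by
    intro a ha ha0
    obtain ⟨r, har, hr⟩ := exists_lt_of_lt_reach ha
    have hr0 : 0 < (r : ℝ) := by
      have := ha0.trans har
      exact_mod_cast this
    refine (addHaar_cthickening_le μ hreg hr0 hε.le hr).trans ?_
    rw [ENNReal.ofReal_coe_nnreal]
    gcongr
  have hcont : Continuous fun a : ℝ≥0∞ =>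
      (1 + ENNReal.ofReal ε * a⁻¹) ^ Module.finrank ℝ F * μ E := by
    refine (ENNReal.continuous_mul_const ht).comp ((ENNReal.continuous_pow _).comp ?_)
    exact continuous_const.add ((ENNReal.continuous_const_mul ENNReal.ofReal_ne_top).comp
      continuous_inv)
  have : (𝓝[<] reach (frontier E)).NeBot := nhdsLT_neBot_of_exists_lt ⟨0, pos_iff_ne_zero.2 h0⟩
  refine ge_of_tendsto (x := 𝓝[<] reach (frontier E))
    ((hcont.tendsto (reach (frontier E))).mono_left nhdsWithin_le_nhds) ?_
  exact Filter.mem_of_superset (Ioo_mem_nhdsLT (pos_iff_ne_zero.2 h0)) fun a ha => hb a ha.2 ha.1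

end

theorem dist_le_of_mem_dyadicCube {n d : ℕ} {m : Fin n → ℤ} {x y : EuclideanSpace ℝ (Fin n)}
    (hx : x ∈ dyadicCube d m) (hy : y ∈ dyadicCube d m) : dist x y ≤ √n / 2 ^ d := by
  rw [EuclideanSpace.dist_eq]
  have h : ∀ i ∈ Finset.univ, dist (x i) (y i) ^ 2 ≤ (1 / 2 ^ d : ℝ) ^ 2 := by
    intro i _
    have h1 := hx i
    have h2 := hy i
    rw [add_div] at h1 h2
    gcongr
    rw [Real.dist_eq, abs_le]
    constructor <;> linarith
  refine (Real.sqrt_le_sqrt (Finset.sum_le_sum h)).trans_eq ?_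
  rw [Finset.sum_const, Finset.card_univ, Fintype.card_fin, nsmul_eq_mul,
    Real.sqrt_mul (by positivity), Real.sqrt_sq (by positivity)]
  ring

theorem cubicalCover_subset_cthickening {n : ℕ} (E : Set (EuclideanSpace ℝ (Fin n))) {d : ℕ}
    {ε : ℝ} (hd : √n / 2 ^ d ≤ ε) : cubicalCover E d ⊆ Metric.cthickening ε E := by
  refine Set.iUnion₂_subset fun m hm x hx => ?_
  obtain ⟨y, hy, hyE⟩ := hm
  exact Metric.mem_cthickening_of_dist_le x y _ _ hyE ((dist_le_of_mem_dyadicCube hx hy).trans hd)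

theorem sqrt_div_two_pow_le {n d : ℕ} (hn : 1 ≤ n) {ε : ℝ} (hε : 0 < ε)
    (hd : Real.logb 2 (√n / ε) ≤ d) : √n / 2 ^ d ≤ ε := by
  have hn' : (0 : ℝ) < √n := Real.sqrt_pos.2 (by exact_mod_cast hn)
  rw [Real.logb_le_iff_le_rpow one_lt_two (by positivity), Real.rpow_natCast,
    div_le_iff₀ hε] at hd
  rw [div_le_iff₀ (by positivity)]
  linarith

end Volume

/-! ### Touching balls and the curvature bound -/

section Normal

variable {n : ℕ} {E : Set (EuclideanSpace ℝ (Fin n))} {x u : EuclideanSpace ℝ (Fin n)}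

/-- The boundary of `E` contains, to first order, every ray orthogonal to an outer unit normal. -/
theorem IsOuterUnitNormal.exists_frontier_near (hx : IsOuterUnitNormal E x u)
    {e : EuclideanSpace ℝ (Fin n)} (he : inner ℝ e u = 0) {η : ℝ} (hη : 0 < η) :
    ∀ᶠ t in 𝓝[>] (0 : ℝ), ∃ v, ‖v‖ ≤ η * t ∧ x + t • e + v ∈ frontier E := by
  obtain ⟨hu, hx⟩ := hx
  -- The displacements t(e ± ηu) have length at most t(‖e‖ + η) and normal component ±tη; this `δ`
  -- puts them outside the cone of uncertainty at `x`.
  set δ := η / (‖e‖ + η + 1)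
  have hden : 0 < ‖e‖ + η + 1 := by positivity
  have hδ : 0 < δ := by positivity
  have hδη : δ * (‖e‖ + η) < η := by
    rw [div_mul_eq_mul_div, div_lt_iff₀ hden]
    nlinarith
  have huu : inner ℝ u u = (1 : ℝ) := by rw [real_inner_self_eq_norm_sq, hu]; norm_num
  have hpt : ∀ c : ℝ, Tendsto (fun t : ℝ => x + t • e + (c * t) • u) (𝓝[>] 0) (𝓝 x) := by
    intro c
    apply Tendsto.mono_left _ nhdsWithin_le_nhds
    have : Continuous fun t : ℝ => x + t • e + (c * t) • u := by fun_prop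
    simpa using this.tendsto 0
  filter_upwards [(hpt η).eventually (hx δ hδ), (hpt (-η)).eventually (hx δ hδ),
    self_mem_nhdsWithin] with t h1 h2 ht
  have ht : 0 < t := ht
  have hsub : ∀ c : ℝ, x + t • e + (c * t) • u - x = t • (e + c • u) := by
    intro c; rw [smul_add, smul_smul, mul_comm t c]; abel
  have hn : ∀ c : ℝ, |c| = η → ‖x + t • e + (c * t) • u - x‖ ≤ t * (‖e‖ + η) := by
    intro c hc
    rw [hsub, norm_smul, Real.norm_eq_abs, abs_of_pos ht]
    gcongr
    refine (norm_add_le _ _).trans_eq ?_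
    rw [norm_smul, hu, Real.norm_eq_abs, hc, mul_one]
  have hi : ∀ c : ℝ, inner ℝ (x + t • e + (c * t) • u - x) u = t * c := by
    intro c
    rw [hsub, real_inner_smul_left, inner_add_left, he, real_inner_smul_left, huu]
    ring
  have hlt : δ * (t * (‖e‖ + η)) < t * η := by nlinarith
  have hout : x + t • e + (η * t) • u ∉ E := by
    refine h1.1 ?_
    rw [hi]
    have := mul_le_mul_of_nonneg_left (hn η (abs_of_pos hη)) hδ.le
    linarith
  have hin : x + t • e + (-η * t) • u ∈ E := by
    refine h2.2 ?_
    rw [hi]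
    have := mul_le_mul_of_nonneg_left (hn (-η) (by rw [abs_neg, abs_of_pos hη])) hδ.le
    linarith
  have hconv : Convex ℝ (Metric.closedBall (x + t • e) (η * t)) := convex_closedBall _ _
  have hmem : ∀ c : ℝ, |c| = η →
      x + t • e + (c * t) • u ∈ Metric.closedBall (x + t • e) (η * t) := by
    intro c hc
    rw [Metric.mem_closedBall, dist_eq_norm, add_sub_cancel_left, norm_smul, hu,
      Real.norm_eq_abs, abs_mul, hc, abs_of_pos ht, mul_one]
  -- Otherwise the connected closed ball of radius ηt about x + te would avoid the frontier while
  -- containing a point of `E` and a point outside.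
  by_contra! hcon
  refine hout (subset_of_isPreconnected_of_disjoint_frontier (G := E) hconv.isPreconnected ?_
    ⟨_, hmem (-η) (by rw [abs_neg, abs_of_pos hη]), hin⟩ (hmem η (abs_of_pos hη)))
  refine Set.disjoint_left.2 fun y hy hyE => ?_
  refine hcon (y - (x + t • e)) ?_ ?_
  · rwa [← dist_eq_norm]
  · simpa using hyE

/-- A boundary point closest to `w` has `w` on its normal line. -/
theorem IsOuterUnitNormal.eq_smul_of_nearest (hx : IsOuterUnitNormal E x u)
    {w : EuclideanSpace ℝ (Fin n)} (hw : ∀ y ∈ frontier E, ‖w - x‖ ≤ ‖w - y‖) :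
    ∃ c : ℝ, w - x = c • u := by
  have hu := hx.1
  refine ⟨inner ℝ (w - x) u, ?_⟩
  set e := w - x - (inner ℝ (w - x) u : ℝ) • u with he
  have huu : inner ℝ u u = (1 : ℝ) := by rw [real_inner_self_eq_norm_sq, hu]; norm_num
  have heu : inner ℝ e u = 0 := by
    rw [he, inner_sub_left, real_inner_smul_left, huu]; ring
  have hwe : inner ℝ (w - x) e = ‖e‖ ^ 2 := by
    have h0 : w - x = e + (inner ℝ (w - x) u : ℝ) • u := by rw [he]; abel
    rw [← real_inner_self_eq_norm_sq, ← sub_eq_zero, ← inner_sub_left, sub_eq_iff_eq_add'.2 h0,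
      real_inner_smul_left, real_inner_comm e u, heu, mul_zero]
  by_contra hne
  have hepos : 0 < ‖e‖ := by rw [norm_pos_iff, he, sub_ne_zero]; exact hne
  set B := ‖w - x‖ + 1
  have hB : 0 < B := by positivity
  -- Moving by te gains 2t‖e‖² in the squared distance to `w`. With this `η` the error v costs at
  -- most half of that at first order, and the quadratic term is smaller than the rest.
  set η := ‖e‖ ^ 2 / (2 * B)
  have hη : 0 < η := by positivity
  have hηB : 2 * η * B = ‖e‖ ^ 2 := by simp only [η]; field_simp
  have hev : ∀ᶠ t in 𝓝[>] (0 : ℝ), t * (‖e‖ + η) ^ 2 < ‖e‖ ^ 2 := by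
    apply nhdsWithin_le_nhds
    have : Continuous fun t : ℝ => t * (‖e‖ + η) ^ 2 := by fun_prop
    exact this.continuousAt.eventually_lt continuousAt_const (by simpa using by positivity)
  obtain ⟨t, ⟨v, hv, hvE⟩, hlt, ht⟩ :=
    ((hx.exists_frontier_near heu hη).and (hev.and self_mem_nhdsWithin)).exists
  have ht : 0 < t := ht
  have h1 := hw _ hvE
  have h2 : w - (x + t • e + v) = (w - x) - (t • e + v) := by abel
  have h3 : ‖w - x‖ ^ 2 ≤ ‖w - (x + t • e + v)‖ ^ 2 := by gcongr
  rw [h2, norm_sub_sq_real (w - x), inner_add_right, inner_smul_right, hwe] at h3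
  have h4 : ‖t • e + v‖ ≤ t * (‖e‖ + η) := by
    refine (norm_add_le _ _).trans ?_
    rw [norm_smul, Real.norm_eq_abs, abs_of_pos ht]
    linarith
  have h5 : ‖t • e + v‖ ^ 2 ≤ (t * (‖e‖ + η)) ^ 2 := by gcongr
  have h6 : -inner ℝ (w - x) v ≤ ‖w - x‖ * ‖v‖ := by
    have := abs_real_inner_le_norm (w - x) v
    exact (neg_le_abs _).trans this
  have h7 : ‖w - x‖ * ‖v‖ ≤ B * (η * t) := by
    gcongr
    simp [B]
  have h8 := mul_lt_mul_of_pos_left hlt ht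
  nlinarith

theorem norm_sub_sq_of_eq_smul {F : Type*} [NormedAddCommGroup F] [InnerProductSpace ℝ F]
    {q x y u : F} {c : ℝ} (h : q - x = c • u) :
    ‖q - y‖ ^ 2 = ‖q - x‖ ^ 2 - 2 * c * inner ℝ (y - x) u + ‖y - x‖ ^ 2 := by
  have h2 : q - y = (q - x) - (y - x) := by abel
  rw [h2, norm_sub_sq_real, h, real_inner_smul_left, real_inner_comm]
  ring

/-- The point x is within r of some centre q, while no frontier point is closer to q than r. So x is
nearest to q at distance exactly r, and q lies on the normal line. -/
theorem exists_touching_ball {G : Set (EuclideanSpace ℝ (Fin n))} {r : ℝ} (hr : 0 < r)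
    (hG : frontier G ⊆ frontier E) (hGd : Disjoint G (frontier E))
    (hu : Metric.cthickening r (frontier E) ⊆ unique (frontier E))
    (hx : IsOuterUnitNormal E x u) (hxE : x ∈ frontier E) (hxG : x ∈ closure G) :
    ∃ q ∈ ballCenters r G, ∃ c : ℝ, |c| = r ∧ q - x = c • u ∧ ∀ y ∈ frontier E, r ≤ ‖q - y‖ := by
  have h := closure_subset_cthickening_ballCenters isClosed_frontier hG hGd hr hu hxG
  rw [(isClosed_ballCenters r G).cthickening_eq_biUnion_closedBall hr.le] at h
  obtain ⟨q, hq, hxq⟩ := Set.mem_iUnion₂.1 h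
  have hfar : ∀ y ∈ frontier E, r ≤ ‖q - y‖ := by
    intro y hy
    rw [← dist_eq_norm, dist_comm]
    exact hq y (Set.disjoint_right.1 hGd hy)
  have hqx : ‖q - x‖ = r := by
    refine le_antisymm ?_ (hfar x hxE)
    rw [← dist_eq_norm, dist_comm]; exact hxq
  obtain ⟨c, hc⟩ := hx.eq_smul_of_nearest (w := q) (fun y hy => hqx.trans_le (hfar y hy))
  refine ⟨q, hq, c, ?_, hc, hfar⟩
  rw [hc, norm_smul, hx.1, mul_one] at hqx
  exact hqx

/-- The two touching balls, in the interior and in the complement, have centres x ± ru. That y lies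
in neither open ball yields, after expanding the squares, the bound for both signs. -/
theorem IsOuterUnitNormal.abs_inner_le (hreg : closure (interior E) = E)
    (hx : IsOuterUnitNormal E x u) (hxE : x ∈ frontier E) {r : ℝ} (hr : 0 < r)
    (hu : Metric.cthickening r (frontier E) ⊆ unique (frontier E)) {y : EuclideanSpace ℝ (Fin n)}
    (hy : y ∈ frontier E) : 2 * r * |inner ℝ (y - x) u| ≤ ‖y - x‖ ^ 2 := by
  have hcl : IsClosed E := by rw [← hreg]; exact isClosed_closure
  have hxE' : x ∈ E := hcl.frontier_subset hxE
  obtain ⟨q, hq, c, hc, hqc, hfar⟩ := exists_touching_ball (G := interior E) hr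
    frontier_interior_subset disjoint_interior_frontier hu hx hxE (by rwa [hreg])
  obtain ⟨q', hq', c', hc', hqc', hfar'⟩ := exists_touching_ball (G := Eᶜ) hr
    (frontier_compl E).subset
    (Set.disjoint_left.2 fun z hz hz' => hz (hcl.frontier_subset hz')) hu hx hxE
    (by rw [closure_compl]; exact hxE.2)
  -- A common centre would lie both in `E` and in its complement.
  have hne : c ≠ c' := by
    rintro rfl
    have : q = q' := by rw [← sub_left_inj (a := x), hqc, hqc']
    subst this
    have h1 := ball_subset_of_mem_ballCenters hq (Metric.mem_ball_self hr)
    exact ball_subset_of_mem_ballCenters hq' (Metric.mem_ball_self hr) (interior_subset h1)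
  have hcc : c' = -c := by
    rcases abs_eq_abs.1 (hc'.trans hc.symm) with h | h
    · exact absurd h.symm hne
    · exact h
  have key : ∀ (q : EuclideanSpace ℝ (Fin n)) (c : ℝ), |c| = r → q - x = c • u →
      r ≤ ‖q - y‖ → 2 * c * inner ℝ (y - x) u ≤ ‖y - x‖ ^ 2 := by
    intro q c hc hq h
    have h1 : r ^ 2 ≤ ‖q - y‖ ^ 2 := by gcongr
    rw [norm_sub_sq_of_eq_smul hq, hq, norm_smul, hx.1, Real.norm_eq_abs, hc] at h1
    nlinarith
  have k1 := key q c hc hqc (hfar y hy)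
  have k2 := key q' c' hc' hqc' (hfar' y hy)
  rw [hcc] at k2
  have : 2 * r * |inner ℝ (y - x) u| = |2 * c * inner ℝ (y - x) u| := by
    rw [abs_mul, abs_mul, hc, abs_two]
  rw [this, abs_le]
  constructor <;> linarith

/-- For a boundary point y = x + tv + o(t), the touching-ball bounds at x and at y add up to r|⟨y -
x, ν(y) - ν(x)⟩| ≤ |y - x|². The left side is rt²|κᵢ| + o(t²), the right side t² + o(t²). -/
theorem HasPrincipalCurvatures.abs_le (hreg : closure (interior E) = E) (hxE : x ∈ frontier E)
    {κ : Fin (n - 1) → ℝ} (hκ : HasPrincipalCurvatures E x κ) (i : Fin (n - 1)) {r : ℝ}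
    (hr : 0 < r) (hu : Metric.cthickening r (frontier E) ⊆ unique (frontier E)) :
    |κ i| * r ≤ 1 := by
  obtain ⟨ν, hν, S, hS, e, he, hei⟩ := hκ
  obtain ⟨heν, hSe⟩ := hei i
  have he1 : ‖e i‖ = 1 := he.1 i
  set v := e i with hv
  have hνx : IsOuterUnitNormal E x (ν x) := hν.self_of_nhdsWithin hxE
  -- All o(t) terms are bounded by a multiple of `η`, so one suitable t suffices for each `η`; after
  -- division by t², `η` tends to 0.
  have bound : ∀ η ∈ Set.Ioo (0 : ℝ) 1,
      |κ i| * r ≤ (1 + η) ^ 2 + r * (η * (1 + η) ^ 2 + ‖S‖ * (η * (1 + η)) + |κ i| * η) := by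
    intro η hη
    obtain ⟨hη0, hη1⟩ := hη
    have hsmall := hν.and ((hasFDerivWithinAt_iff_isLittleO.1 hS).bound hη0)
    obtain ⟨ρ, hρ, hball⟩ := Metric.mem_nhdsWithin_iff.1 hsmall
    have hev : ∀ᶠ t in 𝓝[>] (0 : ℝ), t * 2 < ρ := by
      apply nhdsWithin_le_nhds
      have : Continuous fun t : ℝ => t * 2 := by fun_prop
      exact this.continuousAt.eventually_lt continuousAt_const (by simpa using hρ)
    obtain ⟨t, ⟨w, hw, hwE⟩, hlt, ht⟩ :=
      ((hνx.exists_frontier_near heν hη0).and (hev.and self_mem_nhdsWithin)).exists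
    have ht : 0 < t := ht
    set y := x + t • v + w with hy
    have hyx : y - x = t • v + w := by rw [hy]; abel
    have hyn : ‖y - x‖ ≤ t * (1 + η) := by
      rw [hyx]
      refine (norm_add_le _ _).trans ?_
      rw [norm_smul, he1, Real.norm_eq_abs, abs_of_pos ht]
      linarith
    obtain ⟨hνy, hlin⟩ : IsOuterUnitNormal E y (ν y) ∧
        ‖ν y - ν x - S (y - x)‖ ≤ η * ‖y - x‖ := by
      refine hball ⟨?_, hwE⟩
      rw [Metric.mem_ball, dist_eq_norm]
      nlinarith
    have k1 := hνx.abs_inner_le hreg hxE hr hu hwE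
    have k2 := hνy.abs_inner_le hreg hwE hr hu hxE
    have hD : r * |inner ℝ (y - x) (ν y - ν x)| ≤ ‖y - x‖ ^ 2 := by
      rw [← neg_sub y x, inner_neg_left, abs_neg, norm_neg] at k2
      rw [inner_sub_right]
      have := mul_le_mul_of_nonneg_left
        (abs_sub (inner ℝ (y - x) (ν y)) (inner ℝ (y - x) (ν x))) hr.le
      linarith
    have hsq : ‖y - x‖ ^ 2 ≤ (t * (1 + η)) ^ 2 := by gcongr
    have hR : |inner ℝ (y - x) (ν y - ν x - S (y - x))| ≤ η * (t * (1 + η)) ^ 2 := by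
      refine (abs_real_inner_le_norm _ _).trans ?_
      nlinarith [mul_le_mul_of_nonneg_left hlin (norm_nonneg (y - x))]
    have hvv : inner ℝ v v = (1 : ℝ) := by rw [real_inner_self_eq_norm_sq, he1]; norm_num
    have hexp : inner ℝ (y - x) (S (y - x)) =
        t ^ 2 * κ i + (inner ℝ (y - x) (S w) + t * κ i * inner ℝ w v) := by
      conv_lhs => rw [hyx, map_add, map_smul, hSe, ← hyx, inner_add_right]
      rw [hyx, inner_smul_right, inner_smul_right, inner_add_left, real_inner_smul_left, hvv]
      ring
    have hE1 : |inner ℝ (y - x) (S w)| ≤ t ^ 2 * (‖S‖ * (η * (1 + η))) := by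
      calc |inner ℝ (y - x) (S w)| ≤ ‖y - x‖ * ‖S w‖ := abs_real_inner_le_norm _ _
        _ ≤ (t * (1 + η)) * (‖S‖ * (η * t)) := by
            gcongr
            exact (S.le_opNorm w).trans (by gcongr)
        _ = _ := by ring
    have hE2 : |t * κ i * inner ℝ w v| ≤ t ^ 2 * (|κ i| * η) := by
      rw [abs_mul, abs_mul, abs_of_pos ht]
      calc t * |κ i| * |inner ℝ w v| ≤ t * |κ i| * (‖w‖ * ‖v‖) := by
            gcongr; exact abs_real_inner_le_norm _ _
        _ ≤ t * |κ i| * ((η * t) * 1) := by rw [he1]; gcongr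
        _ = _ := by ring
    have hmain : t ^ 2 * |κ i| ≤ |inner ℝ (y - x) (ν y - ν x)| + η * (t * (1 + η)) ^ 2 +
        (t ^ 2 * (‖S‖ * (η * (1 + η))) + t ^ 2 * (|κ i| * η)) := by
      have h1 : t ^ 2 * κ i = inner ℝ (y - x) (ν y - ν x) -
          inner ℝ (y - x) (ν y - ν x - S (y - x)) -
          (inner ℝ (y - x) (S w) + t * κ i * inner ℝ w v) := by
        rw [inner_sub_right _ (ν y - ν x), hexp]; ring
      have h2 : t ^ 2 * |κ i| = |t ^ 2 * κ i| := by rw [abs_mul, abs_of_nonneg (sq_nonneg t)]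
      rw [h2, h1]
      refine (abs_sub _ _).trans (add_le_add ((abs_sub _ _).trans (add_le_add le_rfl hR)) ?_)
      exact (abs_add_le _ _).trans (add_le_add hE1 hE2)
    have hfin := mul_le_mul_of_nonneg_left hmain hr.le
    have ht2 : 0 < t ^ 2 := by positivity
    refine le_of_mul_le_mul_left ?_ ht2
    nlinarith
  have hlim : Tendsto (fun η : ℝ =>
      (1 + η) ^ 2 + r * (η * (1 + η) ^ 2 + ‖S‖ * (η * (1 + η)) + |κ i| * η)) (𝓝[>] 0) (𝓝 1) := by
    apply Tendsto.mono_left _ nhdsWithin_le_nhds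
    have : Continuous fun η : ℝ =>
      (1 + η) ^ 2 + r * (η * (1 + η) ^ 2 + ‖S‖ * (η * (1 + η)) + |κ i| * η) := by fun_prop
    simpa using this.tendsto 0
  exact ge_of_tendsto hlim (Filter.mem_of_superset (Ioo_mem_nhdsGT (zero_lt_one' ℝ)) bound)

theorem HasPrincipalCurvatures.ofReal_abs_le (hreg : closure (interior E) = E)
    (hxE : x ∈ frontier E) {κ : Fin (n - 1) → ℝ} (hκ : HasPrincipalCurvatures E x κ)
    (i : Fin (n - 1)) : ENNReal.ofReal |κ i| ≤ (reach (frontier E))⁻¹ := by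
  rw [ENNReal.le_inv_iff_le_inv]
  refine iSup₂_le fun r hr => ?_
  rcases eq_or_ne r 0 with rfl | h0
  · simp
  have h := hκ.abs_le hreg hxE i (r := r) (by positivity) hr
  rw [ENNReal.le_inv_iff_le_inv, ENNReal.le_inv_iff_mul_le]
  conv_lhs => rw [← ENNReal.ofReal_coe_nnreal, ← ENNReal.ofReal_mul (abs_nonneg _)]
  exact ENNReal.ofReal_le_one.2 h

end Normal

/-- In `V`, the set `E` is the sublevel set `{g ≤ 0}` of a `C^{1,1}` function `g` with derivative
`D` of norm at least one. -/
structure DefinesBoundary {F : Type*} [NormedAddCommGroup F] [NormedSpace ℝ F] (E V : Set F)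
    (g : F → ℝ) (D : F → F →L[ℝ] ℝ) : Prop where
  hasFDerivAt : ∀ y, HasFDerivAt g (D y) y
  lipschitz : ∃ K, LipschitzWith K D
  one_le : ∀ y, 1 ≤ ‖D y‖
  frontier_iff : ∀ y ∈ V, y ∈ frontier E ↔ g y = 0
  neg : ∀ y ∈ V, g y < 0 → y ∈ E
  pos : ∀ y ∈ V, 0 < g y → y ∉ E

/-! ### Local defining functions -/

section Chart

variable {F H : Type*} [TopologicalSpace F] [NormedAddCommGroup H] [NormedSpace ℝ H]

/-- Over a graph chart, a regular closed set lies on exactly one side of its boundary. -/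
theorem exists_one_sided {E U : Set F} {x : F} (hreg : closure (interior E) = E)
    (hx : x ∈ frontier E) (hU : U ∈ 𝓝 x) {p : F → H} {g : F → ℝ} (hp : Continuous p)
    (hg : Continuous g) {ψ : H × ℝ → F} (hψ : Continuous ψ) (hleft : ∀ y, ψ (p y, g y) = y)
    (hgψ : ∀ z, g (ψ z) = z.2)
    (hEU : ∀ y ∈ U, y ∈ frontier E ↔ g y = 0) (T : Set H) (hT : T ∈ 𝓝 (p x)) :
    ∃ V ∈ 𝓝 x, V ⊆ U ∧ p '' V ⊆ T ∧
      (((∀ y ∈ V, g y < 0 → y ∈ E) ∧ (∀ y ∈ V, 0 < g y → y ∉ E)) ∨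
        ((∀ y ∈ V, 0 < g y → y ∈ E) ∧ (∀ y ∈ V, g y < 0 → y ∉ E))) := by
  have hcl : IsClosed E := by rw [← hreg]; exact isClosed_closure
  have hgx : g x = 0 := (hEU x (mem_of_mem_nhds hU)).1 hx
  have hnhds : ψ ⁻¹' U ∩ (T ×ˢ Set.univ) ∈ 𝓝 (p x, (0 : ℝ)) := by
    refine inter_mem (hψ.continuousAt.preimage_mem_nhds ?_) (prod_mem_nhds hT univ_mem)
    rwa [← hgx, hleft]
  obtain ⟨ρ, hρ, hball⟩ := Metric.mem_nhds_iff.1 hnhds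
  rw [← ball_prod_same] at hball
  set V : Set F := p ⁻¹' Metric.ball (p x) ρ ∩ g ⁻¹' Metric.ball 0 ρ with hV
  have hVn : V ∈ 𝓝 x := inter_mem
    (hp.continuousAt.preimage_mem_nhds (Metric.ball_mem_nhds _ hρ))
    (hg.continuousAt.preimage_mem_nhds (by rw [hgx]; exact Metric.ball_mem_nhds _ hρ))
  have hVball : ∀ y ∈ V, (p y, g y) ∈ Metric.ball (p x) ρ ×ˢ Metric.ball (0 : ℝ) ρ :=
    fun y hy => ⟨hy.1, hy.2⟩
  have hVU : V ⊆ U := fun y hy => by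
    have := (hball (hVball y hy)).1
    rwa [Set.mem_preimage, hleft] at this
  have side : ∀ I : Set ℝ, IsPreconnected I → I ⊆ Metric.ball 0 ρ → (0 : ℝ) ∉ I →
      (∀ y ∈ V, g y ∈ I → y ∈ E) ∨ (∀ y ∈ V, g y ∈ I → y ∉ E) := by
    intro I hI hIρ hI0
    have hpre : IsPreconnected (ψ '' (Metric.ball (p x) ρ ×ˢ I)) :=
      ((convex_ball (p x) ρ).isPreconnected.prod hI).image _ hψ.continuousOn
    have hdisj : Disjoint (ψ '' (Metric.ball (p x) ρ ×ˢ I)) (frontier E) := by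
      refine Set.disjoint_left.2 ?_
      rintro _ ⟨z, hz, rfl⟩ hzE
      have hzU : ψ z ∈ U := (hball ⟨hz.1, hIρ hz.2⟩).1
      rw [hEU _ hzU, hgψ] at hzE
      exact hI0 (hzE ▸ hz.2)
    have hmem : ∀ y ∈ V, g y ∈ I → y ∈ ψ '' (Metric.ball (p x) ρ ×ˢ I) :=
      fun y hy hyI => ⟨(p y, g y), ⟨hy.1, hyI⟩, hleft y⟩
    by_cases hne : (ψ '' (Metric.ball (p x) ρ ×ˢ I) ∩ E).Nonempty
    · exact Or.inl fun y hy hyI =>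
        subset_of_isPreconnected_of_disjoint_frontier hpre hdisj hne (hmem y hy hyI)
    · exact Or.inr fun y hy hyI hyE => hne ⟨y, hmem y hy hyI, hyE⟩
  have habs : ∀ y ∈ V, |g y| < ρ := fun y hy => by
    have := hy.2
    rwa [Set.mem_preimage, Metric.mem_ball, dist_zero_right, Real.norm_eq_abs] at this
  have hplus := side (Set.Ioo 0 ρ) isPreconnected_Ioo
    (fun s hs => by
      rw [Metric.mem_ball, dist_zero_right, Real.norm_eq_abs, abs_of_pos hs.1]; exact hs.2)
    (by simp)
  have hminus := side (Set.Ioo (-ρ) 0) isPreconnected_Ioo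
    (fun s hs => by
      rw [Metric.mem_ball, dist_zero_right, Real.norm_eq_abs, abs_of_neg hs.2]
      linarith [hs.1])
    (by simp)
  have hP : ∀ y ∈ V, 0 < g y → g y ∈ Set.Ioo 0 ρ := fun y hy h =>
    ⟨h, (abs_lt.1 (habs y hy)).2⟩
  have hM : ∀ y ∈ V, g y < 0 → g y ∈ Set.Ioo (-ρ) 0 := fun y hy h =>
    ⟨(abs_lt.1 (habs y hy)).1, h⟩
  refine ⟨V, hVn, hVU, ?_, ?_⟩
  · rintro _ ⟨y, hy, rfl⟩
    exact (hball (hVball y hy)).2.1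
  -- If both sides lie in `E`, then `x` is an interior point; if neither does, then `x` is not in
  -- the closure of the interior.
  rcases hplus with hp1 | hp1 <;> rcases hminus with hm1 | hm1
  · exfalso
    refine hx.2 (mem_interior_iff_mem_nhds.2 (mem_of_superset hVn fun y hy => ?_))
    rcases lt_trichotomy (g y) 0 with h | h | h
    · exact hm1 y hy (hM y hy h)
    · exact hcl.frontier_subset ((hEU y (hVU hy)).2 h)
    · exact hp1 y hy (hP y hy h)
  · exact Or.inr ⟨fun y hy h => hp1 y hy (hP y hy h), fun y hy h => hm1 y hy (hM y hy h)⟩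
  · exact Or.inl ⟨fun y hy h => hm1 y hy (hM y hy h), fun y hy h => hp1 y hy (hP y hy h)⟩
  · exfalso
    have hxc : x ∈ closure (interior E) := by rw [hreg]; exact hcl.frontier_subset hx
    obtain ⟨y, hy, hyi⟩ := mem_closure_iff_nhds.1 hxc V hVn
    rcases lt_trichotomy (g y) 0 with h | h | h
    · exact hm1 y hy (hM y hy h) (interior_subset hyi)
    · exact ((hEU y (hVU hy)).2 h).2 hyi
    · exact hp1 y hy (hP y hy h) (interior_subset hyi)

end Chart

theorem IsC11.contDiff {k : ℕ} {f : EuclideanSpace ℝ (Fin k) → ℝ} (hf : IsC11 f) :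
    ContDiff ℝ 1 f := by
  obtain ⟨hd, K, hK⟩ := hf
  exact contDiff_one_iff_fderiv.2 ⟨hd, hK.continuous⟩

/-- In chart coordinates take g = ±(height - f). Rademacher's theorem makes the bad set of the
derivative of f null in the base, and the locally Lipschitz graph map carries it to a null set of
the boundary. -/
theorem HasC11Boundary.exists_definesBoundary {n : ℕ} {E : Set (EuclideanSpace ℝ (Fin n))}
    (hreg : closure (interior E) = E) (hC : HasC11Boundary E) {x : EuclideanSpace ℝ (Fin n)}
    (hx : x ∈ frontier E) :
    ∃ V ∈ 𝓝 x, ∃ g D, DefinesBoundary E V g D ∧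
      (μH[((n - 1 : ℕ) : ℝ)] : Measure (EuclideanSpace ℝ (Fin n)))
        {y ∈ frontier E ∩ V | ¬ DifferentiableAt ℝ D y} = 0 := by
  obtain ⟨U, hU, Φ, f, hf, hEU⟩ := hC x hx
  obtain ⟨hfd, K, hK⟩ := id hf
  set P : EuclideanSpace ℝ (Fin n) →L[ℝ] EuclideanSpace ℝ (Fin (n - 1)) :=
    (WithLp.fstL 2 ℝ _ ℝ).comp (Φ : _ →L[ℝ] WithLp 2 (EuclideanSpace ℝ (Fin (n - 1)) × ℝ))
    with hPdef
  set Q : EuclideanSpace ℝ (Fin n) →L[ℝ] ℝ :=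
    (WithLp.sndL 2 ℝ (EuclideanSpace ℝ (Fin (n - 1))) ℝ).comp
      (Φ : _ →L[ℝ] WithLp 2 (EuclideanSpace ℝ (Fin (n - 1)) × ℝ)) with hQdef
  have hP : ∀ y, P y = (Φ y).fst := fun y => rfl
  have hQ : ∀ y, Q y = (Φ y).snd := fun y => rfl
  set ι : EuclideanSpace ℝ (Fin (n - 1)) × ℝ →L[ℝ] EuclideanSpace ℝ (Fin n) :=
    (Φ.symm : WithLp 2 (EuclideanSpace ℝ (Fin (n - 1)) × ℝ) →L[ℝ] _).comp
      ((WithLp.prodContinuousLinearEquiv 2 ℝ (EuclideanSpace ℝ (Fin (n - 1))) ℝ).symm :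
        _ →L[ℝ] WithLp 2 (EuclideanSpace ℝ (Fin (n - 1)) × ℝ)) with hιdef
  have hι : ∀ z, ι z = Φ.symm (WithLp.toLp 2 z) := fun z => rfl
  have hPι : ∀ z, P (ι z) = z.1 := fun z => by rw [hP, hι, Φ.apply_symm_apply]; rfl
  have hQι : ∀ z, Q (ι z) = z.2 := fun z => by rw [hQ, hι, Φ.apply_symm_apply]; rfl
  have hιP : ∀ y, ι (P y, Q y) = y := fun y => by
    rw [hι, LinearIsometryEquiv.symm_apply_eq]; rfl
  set g : EuclideanSpace ℝ (Fin n) → ℝ := fun y => Q y - f (P y) with hg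
  set D : EuclideanSpace ℝ (Fin n) → EuclideanSpace ℝ (Fin n) →L[ℝ] ℝ :=
    fun y => Q - (fderiv ℝ f (P y)).comp P with hD
  have hgD : ∀ y, HasFDerivAt g (D y) y := fun y =>
    Q.hasFDerivAt.sub ((hfd (P y)).hasFDerivAt.comp y P.hasFDerivAt)
  have hDL : ∃ K', LipschitzWith K' D := by
    have h1 := ((ContinuousLinearMap.compL ℝ (EuclideanSpace ℝ (Fin n))
      (EuclideanSpace ℝ (Fin (n - 1))) ℝ).flip P).lipschitz.comp (hK.comp P.lipschitz)
    exact ⟨_, (LipschitzWith.const Q).sub h1⟩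
  -- The derivative along the vertical unit vector is 1.
  have hD1 : ∀ y, 1 ≤ ‖D y‖ := fun y => by
    have h1 : D y (ι (0, 1)) = 1 := by
      simp only [hD, sub_apply, ContinuousLinearMap.comp_apply, hQι, hPι,
        map_zero, sub_zero]
    have h2 : ‖ι (0, 1)‖ = 1 := by
      rw [hι, LinearIsometryEquiv.norm_map, WithLp.prod_norm_eq_of_L2]
      simp
    have h3 := (D y).le_opNorm (ι (0, 1))
    rwa [h1, h2, mul_one, norm_one] at h3
  have hfr : ∀ y ∈ U, y ∈ frontier E ↔ g y = 0 := fun y hy => by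
    have h1 : y ∈ frontier E ↔ y ∈ frontier E ∩ U := ⟨fun h => ⟨h, hy⟩, fun h => h.1⟩
    rw [h1, hEU, hg]
    simp only [hP, hQ, sub_eq_zero]
    exact ⟨fun h => h.1, fun h => ⟨h, hy⟩⟩
  set γ : EuclideanSpace ℝ (Fin (n - 1)) → EuclideanSpace ℝ (Fin n) := fun p => ι (p, f p) with hγ
  have hγc : ContDiff ℝ 1 γ := ι.contDiff.comp (contDiff_id.prodMk hf.contDiff)
  obtain ⟨K', T, hT, hK'⟩ := (hγc.contDiffAt (x := P x)).exists_lipschitzOnWith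
  obtain ⟨V, hV, hVU, hVT, hside⟩ := exists_one_sided hreg hx hU (p := P) (g := g) P.continuous
    (Q.continuous.sub (hfd.continuous.comp P.continuous))
    (ψ := fun z => ι (z.1, z.2 + f z.1))
    (ι.continuous.comp (continuous_fst.prodMk
      (continuous_snd.add (hfd.continuous.comp continuous_fst))))
    (fun y => by simp only [hg, sub_add_cancel, hιP])
    (fun z => by simp only [hg, hPι, hQι, add_sub_cancel_right]) hfr T hT
  have hnull : (μH[((n - 1 : ℕ) : ℝ)] : Measure (EuclideanSpace ℝ (Fin n)))
      {y ∈ frontier E ∩ V | ¬ DifferentiableAt ℝ D y} = 0 := by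
    set N := {p | ¬ DifferentiableAt ℝ (fderiv ℝ f) p}
    have hN : (μH[((n - 1 : ℕ) : ℝ)] : Measure (EuclideanSpace ℝ (Fin (n - 1)))) N = 0 :=
      hK.ae_differentiableAt
    have hsub : {y ∈ frontier E ∩ V | ¬ DifferentiableAt ℝ D y} ⊆ γ '' (T ∩ N) := by
      rintro y ⟨⟨hyE, hyV⟩, hyD⟩
      refine ⟨P y, ⟨hVT ⟨y, hyV, rfl⟩, fun hdiff => hyD ?_⟩, ?_⟩
      · have h1 : DifferentiableAt ℝ (fun y => fderiv ℝ f (P y)) y :=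
          DifferentiableAt.comp y hdiff P.differentiableAt
        exact (differentiableAt_const Q).sub (h1.clm_comp (differentiableAt_const P))
      · have h2 : f (P y) = Q y := by
          have := (hfr y (hVU hyV)).1 hyE
          simp only [hg] at this
          linarith
        simp only [hγ, h2, hιP]
    refine measure_mono_null hsub (le_antisymm ?_ zero_le)
    refine ((hK'.mono Set.inter_subset_left).hausdorffMeasure_image_le (by positivity)).trans ?_
    rw [measure_mono_null Set.inter_subset_right hN, mul_zero]
  rcases hside with ⟨h1, h2⟩ | ⟨h1, h2⟩
  · exact ⟨V, hV, g, D, ⟨hgD, hDL, hD1, fun y hy => hfr y (hVU hy), h1, h2⟩, hnull⟩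
  · refine ⟨V, hV, fun y => -g y, fun y => -D y, ⟨fun y => (hgD y).neg, ?_, ?_, ?_, ?_, ?_⟩, ?_⟩
    · obtain ⟨K, hK⟩ := hDL
      exact ⟨K, hK.neg⟩
    · simpa using hD1
    · intro y hy
      rw [hfr y (hVU hy), neg_eq_zero]
    · exact fun y hy h => h1 y hy (by linarith)
    · exact fun y hy h => h2 y hy (by linarith)
    · have : ∀ y, DifferentiableAt ℝ (fun y => -D y) y ↔ DifferentiableAt ℝ D y :=
        fun y => differentiableAt_fun_neg_iff
      simpa only [this] using hnull

/-! ### The normalized gradient and its derivative -/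

section Gradient

variable {F : Type*} [NormedAddCommGroup F] [InnerProductSpace ℝ F] [CompleteSpace F]

/-- The Riesz representation as a real linear map. -/
noncomputable def rieszMap : (F →L[ℝ] ℝ) →L[ℝ] F :=
  LinearMap.mkContinuous
    { toFun := fun l => (InnerProductSpace.toDual ℝ F).symm l
      map_add' := fun a b => map_add _ a b
      map_smul' := fun c a => by simp } 1 (fun l => by simp)

theorem inner_rieszMap (l : F →L[ℝ] ℝ) (v : F) : inner ℝ (rieszMap l) v = l v :=
  InnerProductSpace.toDual_symm_apply

theorem norm_rieszMap (l : F →L[ℝ] ℝ) : ‖rieszMap l‖ = ‖l‖ :=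
  (InnerProductSpace.toDual ℝ F).symm.norm_map l

/-- The normalized gradient. -/
noncomputable def unitNormal (D : F → F →L[ℝ] ℝ) (y : F) : F :=
  ‖rieszMap (D y)‖⁻¹ • rieszMap (D y)

theorem inner_unitNormal (D : F → F →L[ℝ] ℝ) (y v : F) :
    inner ℝ v (unitNormal D y) = ‖D y‖⁻¹ * D y v := by
  rw [unitNormal, real_inner_smul_right, real_inner_comm, inner_rieszMap, norm_rieszMap]

theorem norm_unitNormal {D : F → F →L[ℝ] ℝ} {y : F} (h : D y ≠ 0) : ‖unitNormal D y‖ = 1 := by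
  rw [unitNormal, norm_smul, norm_inv, norm_norm, norm_rieszMap,
    inv_mul_cancel₀ (norm_ne_zero_iff.2 h)]

theorem differentiableAt_unitNormal {D : F → F →L[ℝ] ℝ} {x : F} (hD : DifferentiableAt ℝ D x)
    (h : D x ≠ 0) : DifferentiableAt ℝ (unitNormal D) x := by
  have h1 : DifferentiableAt ℝ (fun y => rieszMap (D y)) x :=
    rieszMap.differentiableAt.comp x hD
  have h2 : rieszMap (D x) ≠ 0 := by
    rw [← norm_ne_zero_iff, norm_rieszMap]; exact norm_ne_zero_iff.2 h
  exact ((h1.norm ℝ h2).inv (norm_ne_zero_iff.2 h2)).smul h1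

theorem inner_fderiv_unitNormal_self {D : F → F →L[ℝ] ℝ} {x : F} (hD : DifferentiableAt ℝ D x)
    (h : ∀ y, D y ≠ 0) (v : F) :
    inner ℝ (fderiv ℝ (unitNormal D) x v) (unitNormal D x) = 0 := by
  have h1 := (differentiableAt_unitNormal hD (h x)).hasFDerivAt
  have h2 := h1.inner ℝ h1
  have h3 : (fun y => inner ℝ (unitNormal D y) (unitNormal D y)) = fun _ => (1 : ℝ) := by
    ext y
    rw [real_inner_self_eq_norm_sq, norm_unitNormal (h y), one_pow]
  rw [h3] at h2
  have h4 := congrArg (fun L => L v) (h2.unique (hasFDerivAt_const (1 : ℝ) x))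
  simp only [ContinuousLinearMap.comp_apply, ContinuousLinearMap.prod_apply,
    fderivInnerCLM_apply, zero_apply] at h4
  rw [real_inner_comm] at h4
  linarith

/-- In the product rule, the derivative of the normalizing factor is multiplied by D x w = 0. The
shape operator thus inherits the symmetry of the second derivative. -/
theorem inner_fderiv_unitNormal_of_tangent {D : F → F →L[ℝ] ℝ} {x : F}
    (hD : DifferentiableAt ℝ D x) (h : D x ≠ 0) (v : F) {w : F} (hw : D x w = 0) :
    inner ℝ (fderiv ℝ (unitNormal D) x v) w = ‖D x‖⁻¹ * fderiv ℝ D x v w := by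
  have h1 := (differentiableAt_unitNormal hD h).hasFDerivAt
  have h2 := h1.inner ℝ (hasFDerivAt_const w x)
  have h3 : (fun y => inner ℝ (unitNormal D y) w) =
      fun y => ‖rieszMap (D y)‖⁻¹ * D y w := by
    ext y
    rw [real_inner_comm, inner_unitNormal, norm_rieszMap]
  have hr : rieszMap (D x) ≠ 0 := by
    rw [← norm_ne_zero_iff, norm_rieszMap]; exact norm_ne_zero_iff.2 h
  have h4 : DifferentiableAt ℝ (fun y => ‖rieszMap (D y)‖⁻¹) x :=
    ((rieszMap.differentiableAt.comp x hD).norm ℝ hr).inv (norm_ne_zero_iff.2 hr)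
  have h5 := h4.hasFDerivAt.mul (hD.hasFDerivAt.clm_apply (hasFDerivAt_const w x))
  rw [h3] at h2
  have h6 := congrArg (fun L => L v) (h2.unique h5)
  simpa [hw, norm_rieszMap] using h6

end Gradient

/-! ### Existence of curvatures and positivity of the reach -/

section Curvature

variable {n : ℕ} {E V : Set (EuclideanSpace ℝ (Fin n))} {g : EuclideanSpace ℝ (Fin n) → ℝ}
  {D : EuclideanSpace ℝ (Fin n) → EuclideanSpace ℝ (Fin n) →L[ℝ] ℝ}
  {x y : EuclideanSpace ℝ (Fin n)}

theorem DefinesBoundary.ne_zero (h : DefinesBoundary E V g D) (y : EuclideanSpace ℝ (Fin n)) :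
    D y ≠ 0 := norm_pos_iff.1 (lt_of_lt_of_le one_pos (h.one_le y))

theorem DefinesBoundary.isOuterUnitNormal (h : DefinesBoundary E V g D) (hV : V ∈ 𝓝 y)
    (hy : y ∈ frontier E) : IsOuterUnitNormal E y (unitNormal D y) := by
  refine ⟨norm_unitNormal (h.ne_zero y), fun η hη => ?_⟩
  have hgy : g y = 0 := (h.frontier_iff y (mem_of_mem_nhds hV)).1 hy
  have hD := h.one_le y
  have hD0 : 0 < ‖D y‖ := lt_of_lt_of_le one_pos hD
  filter_upwards [(hasFDerivAt_iff_isLittleO.1 (h.hasFDerivAt y)).bound hη, hV] with z hz hzV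
  rw [inner_unitNormal, hgy, sub_zero, Real.norm_eq_abs, abs_le] at *
  have hscale : η * ‖z - y‖ ≤ ‖D y‖ * (η * ‖z - y‖) :=
    le_mul_of_one_le_left (by positivity) hD
  constructor
  · intro hlt
    refine h.pos z hzV ?_
    rw [lt_inv_mul_iff₀ hD0] at hlt
    linarith [hz.1]
  · intro hlt
    refine h.neg z hzV ?_
    rw [inv_mul_lt_iff₀ hD0] at hlt
    linarith [hz.2]

/-- The normal has constant length, so its differential maps the tangent space into itself. It is
symmetric there, and the spectral theorem applies. -/
theorem DefinesBoundary.hasPrincipalCurvatures (h : DefinesBoundary E V g D) (hV : V ∈ 𝓝 x)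
    (hD : DifferentiableAt ℝ D x) : ∃ κ, HasPrincipalCurvatures E x κ := by
  set ν := unitNormal D
  have hνx : ‖ν x‖ = 1 := norm_unitNormal (h.ne_zero x)
  set S := fderiv ℝ ν x
  set K := (ℝ ∙ ν x)ᗮ
  have hmem : ∀ v, v ∈ K ↔ D x v = 0 := by
    intro v
    rw [Submodule.mem_orthogonal_singleton_iff_inner_left, inner_unitNormal, mul_eq_zero]
    simp [h.ne_zero x]
  have hSK : ∀ v : K, S v ∈ K := fun v =>
    Submodule.mem_orthogonal_singleton_iff_inner_left.2
      (inner_fderiv_unitNormal_self hD h.ne_zero _)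
  set T : K →ₗ[ℝ] K := ((S : _ →ₗ[ℝ] EuclideanSpace ℝ (Fin n)).comp K.subtype).codRestrict K hSK
  have hT : T.IsSymmetric := by
    intro v w
    change inner ℝ (S v) (w : EuclideanSpace ℝ (Fin n)) =
      inner ℝ (v : EuclideanSpace ℝ (Fin n)) (S w)
    rw [real_inner_comm (S w),
      inner_fderiv_unitNormal_of_tangent hD (h.ne_zero x) _ ((hmem _).1 w.2),
      inner_fderiv_unitNormal_of_tangent hD (h.ne_zero x) _ ((hmem _).1 v.2),
      second_derivative_symmetric h.hasFDerivAt hD.hasFDerivAt]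
  have hfin : Module.finrank ℝ K = n - 1 := by
    have h1 := Submodule.finrank_add_finrank_orthogonal (ℝ ∙ ν x)
    rw [finrank_span_singleton (norm_ne_zero_iff.1 (by rw [hνx]; exact one_ne_zero)),
      finrank_euclideanSpace_fin] at h1
    exact Nat.eq_sub_of_add_eq' h1
  refine ⟨hT.eigenvalues hfin, ν, ?_, S,
    (differentiableAt_unitNormal hD (h.ne_zero x)).hasFDerivAt.hasFDerivWithinAt,
    fun i => (hT.eigenvectorBasis hfin i : EuclideanSpace ℝ (Fin n)), ?_, fun i => ⟨?_, ?_⟩⟩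
  · filter_upwards [nhdsWithin_le_nhds (eventually_mem_nhds_iff.2 hV), self_mem_nhdsWithin]
      with y hy hyE
    exact h.isOuterUnitNormal hy hyE
  · exact (hT.eigenvectorBasis hfin).orthonormal.comp_linearIsometry K.subtypeₗᵢ
  · exact Submodule.mem_orthogonal_singleton_iff_inner_left.1 (hT.eigenvectorBasis hfin i).2
  · exact congrArg Subtype.val (hT.apply_eigenvectorBasis hfin i)

theorem DefinesBoundary.abs_inner_le (h : DefinesBoundary E V g D) {K : ℝ≥0}
    (hK : LipschitzWith K D) (hxV : x ∈ V) (hx : x ∈ frontier E) (hyV : y ∈ V)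
    (hy : y ∈ frontier E) : |inner ℝ (y - x) (unitNormal D x)| ≤ K * ‖y - x‖ ^ 2 := by
  have h1 : ‖g y - g x - D x (y - x)‖ ≤ K * ‖y - x‖ * ‖y - x‖ := by
    refine (convex_segment x y).norm_image_sub_le_of_norm_hasFDerivWithin_le'
      (fun z _ => (h.hasFDerivAt z).hasFDerivWithinAt) (fun z hz => ?_)
      (left_mem_segment ℝ x y) (right_mem_segment ℝ x y)
    rw [← dist_eq_norm]
    refine (hK.dist_le_mul z x).trans ?_
    gcongr
    rw [dist_eq_norm]
    exact norm_sub_le_of_mem_segment hz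
  rw [(h.frontier_iff x hxV).1 hx, (h.frontier_iff y hyV).1 hy, sub_zero, zero_sub, norm_neg,
    Real.norm_eq_abs] at h1
  rw [inner_unitNormal, abs_mul, abs_of_nonneg (by positivity)]
  calc ‖D x‖⁻¹ * |D x (y - x)| ≤ 1 * |D x (y - x)| := by
        gcongr; exact inv_le_one_of_one_le₀ (h.one_le x)
    _ ≤ K * ‖y - x‖ ^ 2 := by rw [one_mul]; linarith

theorem HasC11Boundary.exists_quadratic_bound (hreg : closure (interior E) = E)
    (hC : HasC11Boundary E) (hcomp : IsCompact (frontier E)) :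
    ∃ M : ℝ, ∀ x ∈ frontier E, ∃ u, IsOuterUnitNormal E x u ∧
      ∀ y ∈ frontier E, |inner ℝ (y - x) u| ≤ M * ‖y - x‖ ^ 2 := by
  -- Compactness induction runs over sets that need not lie in the frontier, so membership is
  -- carried separately.
  suffices H : ∃ M : ℝ, ∀ x ∈ frontier E, x ∈ frontier E → ∃ u, IsOuterUnitNormal E x u ∧
      ∀ y ∈ frontier E, |inner ℝ (y - x) u| ≤ M * ‖y - x‖ ^ 2 by
    obtain ⟨M, hM⟩ := H
    exact ⟨M, fun x hx => hM x hx hx⟩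
  refine hcomp.induction_on (p := fun s => ∃ M : ℝ, ∀ x ∈ s, x ∈ frontier E →
    ∃ u, IsOuterUnitNormal E x u ∧ ∀ y ∈ frontier E, |inner ℝ (y - x) u| ≤ M * ‖y - x‖ ^ 2)
    ⟨0, by simp⟩ ?_ ?_ ?_
  · rintro s t hst ⟨M, hM⟩
    exact ⟨M, fun x hx => hM x (hst hx)⟩
  · rintro s t ⟨M, hM⟩ ⟨M', hM'⟩
    refine ⟨max M M', fun x hx hxE => ?_⟩
    rcases hx with hx | hx
    · obtain ⟨u, hu, h⟩ := hM x hx hxE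
      exact ⟨u, hu, fun y hy => (h y hy).trans (by gcongr; exact le_max_left _ _)⟩
    · obtain ⟨u, hu, h⟩ := hM' x hx hxE
      exact ⟨u, hu, fun y hy => (h y hy).trans (by gcongr; exact le_max_right _ _)⟩
  · intro x hx
    obtain ⟨V, hV, g, D, h, -⟩ := hC.exists_definesBoundary hreg hx
    obtain ⟨K, hK⟩ := h.lipschitz
    obtain ⟨ρ, hρ, hball⟩ := Metric.mem_nhds_iff.1 hV
    -- For y in the chart ball, Taylor's formula gives the constant `K`. Otherwise ‖y - z‖ ≥ ρ/2,
    -- and Cauchy–Schwarz gives 2/ρ.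
    refine ⟨Metric.ball x (ρ / 2), mem_nhdsWithin_of_mem_nhds (Metric.ball_mem_nhds _ (by positivity)),
      K + 2 / ρ, fun z hz hzE => ?_⟩
    have hzρ : z ∈ Metric.ball x ρ := Metric.ball_subset_ball (by linarith) hz
    have hn := h.isOuterUnitNormal (mem_of_superset (Metric.isOpen_ball.mem_nhds hzρ) hball) hzE
    refine ⟨unitNormal D z, hn, fun y hy => ?_⟩
    rw [add_mul]
    rcases lt_or_ge (dist y x) ρ with hlt | hge
    · have := h.abs_inner_le hK (hball hzρ) hzE (hball hlt) hy
      exact this.trans (le_add_of_nonneg_right (by positivity))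
    · have hd : ρ / 2 ≤ ‖y - z‖ := by
        rw [← dist_eq_norm]
        have := dist_triangle y z x
        rw [Metric.mem_ball] at hz
        linarith
      have h1 : |inner ℝ (y - z) (unitNormal D z)| ≤ ‖y - z‖ := by
        simpa [hn.1] using abs_real_inner_le_norm (y - z) (unitNormal D z)
      have h2 : ‖y - z‖ ≤ 2 / ρ * ‖y - z‖ ^ 2 := by
        rw [div_mul_eq_mul_div, le_div_iff₀ hρ]
        nlinarith [norm_nonneg (y - z)]
      exact (h1.trans h2).trans (le_add_of_nonneg_left (by positivity))

theorem HasC11Boundary.reach_pos (hreg : closure (interior E) = E) (hC : HasC11Boundary E)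
    (hcomp : IsCompact (frontier E)) : 0 < reach (frontier E) := by
  obtain ⟨M, hM⟩ := hC.exists_quadratic_bound hreg hcomp
  -- If y and y' are both nearest to z = y + cu with |c| ≤ r, then ‖y' - y‖² = 2c⟨y' - y, u⟩. This
  -- `r` makes the right side at most ‖y' - y‖²/2, so y' = y.
  set r : ℝ≥0 := ⟨(4 * (|M| + 1))⁻¹, by positivity⟩
  have hr : (r : ℝ) = (4 * (|M| + 1))⁻¹ := rfl
  have hr0 : (0 : ℝ) < r := by rw [hr]; positivity
  suffices h : Metric.cthickening (r : ℝ) (frontier E) ⊆ unique (frontier E) from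
    lt_of_lt_of_le (by exact_mod_cast hr0) (le_iSup₂ (f := fun (r : ℝ≥0)
      (_ : Metric.cthickening (r : ℝ) (frontier E) ⊆ unique (frontier E)) => (r : ℝ≥0∞)) r h)
  intro z hz
  rcases (frontier E).eq_empty_or_nonempty with he | hne
  · simp [he] at hz
  rw [mem_cthickening_iff_infDist_le hne hr0.le] at hz
  obtain ⟨y, hy, hzy⟩ := isClosed_frontier.exists_infDist_eq_dist hne z
  refine ⟨y, ⟨hy, hzy⟩, fun y' hy' => ?_⟩
  obtain ⟨hy'E, hzy'⟩ := hy'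
  obtain ⟨u, hu, hquad⟩ := hM y hy
  obtain ⟨c, hc⟩ := hu.eq_smul_of_nearest (w := z) fun p hp => by
    rw [← dist_eq_norm, ← dist_eq_norm, ← hzy]
    exact Metric.infDist_le_dist_of_mem hp
  have h1 := norm_sub_sq_of_eq_smul (y := y') hc
  have h2 : ‖z - y'‖ = ‖z - y‖ := by rw [← dist_eq_norm, ← dist_eq_norm, ← hzy, ← hzy']
  have hcr : |c| ≤ r := by
    rw [hzy, dist_eq_norm, hc, norm_smul, hu.1, mul_one] at hz
    exact hz
  have h3 : c * inner ℝ (y' - y) u ≤ r * ((|M| + 1) * ‖y' - y‖ ^ 2) := by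
    refine (le_abs_self _).trans ?_
    rw [abs_mul]
    refine mul_le_mul hcr ((hquad y' hy'E).trans ?_) (abs_nonneg _) hr0.le
    gcongr
    linarith [le_abs_self M]
  have h4 : (r : ℝ) * ((|M| + 1) * ‖y' - y‖ ^ 2) = ‖y' - y‖ ^ 2 / 4 := by
    rw [hr]; field_simp
  rw [h2] at h1
  have h5 : ‖y' - y‖ ^ 2 = 0 := le_antisymm (by linarith) (sq_nonneg _)
  rwa [sq_eq_zero_iff, norm_eq_zero, sub_eq_zero] at h5

theorem HasC11Boundary.ae_hasPrincipalCurvatures (hreg : closure (interior E) = E)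
    (hC : HasC11Boundary E) :
    ∀ᵐ x ∂((μH[((n - 1 : ℕ) : ℝ)] : Measure (EuclideanSpace ℝ (Fin n))).restrict (frontier E)),
      x ∈ frontier E ∧ ∃ κ, HasPrincipalCurvatures E x κ := by
  rw [ae_restrict_iff' isClosed_frontier.measurableSet]
  refine measure_null_of_locally_null _ fun x hx => ?_
  have hxE : x ∈ frontier E := by
    by_contra h
    exact hx fun h' => absurd h' h
  obtain ⟨V, hV, g, D, h, hnull⟩ := hC.exists_definesBoundary hreg hxE
  refine ⟨_, inter_mem_nhdsWithin _ (interior_mem_nhds.2 hV), measure_mono_null ?_ hnull⟩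
  rintro y ⟨hy, hyV⟩
  have hyE : y ∈ frontier E := by
    by_contra h
    exact hy fun h' => absurd h' h
  refine ⟨⟨hyE, interior_subset hyV⟩, fun hD => hy fun _ => ⟨hyE, ?_⟩⟩
  exact h.hasPrincipalCurvatures (mem_interior_iff_mem_nhds.1 hyV) hD

end Curvature

end CubicalCover

theorem mainTheorem3 (n : ℕ) (hn : 1 ≤ n) (E : Set (EuclideanSpace ℝ (Fin n)))
    (hE : IsClosed E) (hreg : closure (interior E) = E)
    (hC : CubicalCover.HasC11Boundary E) :
    (IsCompact (frontier E) → 0 < CubicalCover.reach (frontier E)) ∧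
    (∀ᵐ x ∂((μH[((n - 1 : ℕ) : ℝ)] : Measure (EuclideanSpace ℝ (Fin n))).restrict (frontier E)),
      (∃ κ, CubicalCover.HasPrincipalCurvatures E x κ) ∧
      ∀ κ, CubicalCover.HasPrincipalCurvatures E x κ →
        ∀ i, ENNReal.ofReal |κ i| ≤ (CubicalCover.reach (frontier E))⁻¹) ∧
    (∀ ε : ℝ, 0 < ε →
      volume (Metric.thickening ε E) ≤
        (1 + ENNReal.ofReal ε * (CubicalCover.reach (frontier E))⁻¹) ^ n * volume E ∧
      ∀ d : ℕ, Real.logb 2 (√(n : ℝ) / ε) ≤ (d : ℝ) →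
        volume (CubicalCover.cubicalCover E d) ≤
          (1 + ENNReal.ofReal ε * (CubicalCover.reach (frontier E))⁻¹) ^ n * volume E) := by
  refine ⟨hC.reach_pos hreg, ?_, fun ε hε => ?_⟩
  · filter_upwards [hC.ae_hasPrincipalCurvatures hreg] with x hx
    exact ⟨hx.2, fun κ hκ i => hκ.ofReal_abs_le hreg hx.1 i⟩
  · have h := CubicalCover.addHaar_cthickening_le_reach volume hreg
      (by rw [finrank_euclideanSpace_fin]; omega) hε
    rw [finrank_euclideanSpace_fin] at h
    exact ⟨(measure_mono (Metric.thickening_subset_cthickening ε E)).trans h, fun d hd =>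
      (measure_mono (CubicalCover.cubicalCover_subset_cthickening E
        (CubicalCover.sqrt_div_two_pow_le hn hε hd))).trans h⟩
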